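/- Let $n\ge 1$ and let $B\subset\mathbb R^n$ be a convex set with $0\in\operatorname{int}B$ (not necessarily centrally symmetric). For an orthonormal frame $\nu_{k+1},\dots,\nu_n$ in $\mathbb R^n$ let $B^{(k)}(\nu_{k+1},\dots,\nu_n)$ be the intersection of $B$ with the $k$-dimensional subspace $\{\nu_{k+1},\dots,\nu_n\}^\perp$, and let $\partial B^{(k)}(\nu_{k+1},\dots,\nu_n)$ be its boundary relative to that subspace. Define recursively $\omega^{(1)}_B(\nu_2,\dots,\nu_n)=2$ and, for $2\le k\le n$, $$\omega_B^{(k)}(\nu_{k+1},\dots,\nu_n)=\frac1k\int_{\partial B^{(k)}(\nu_{k+1},\dots,\nu_n)}\frac{\omega_B^{(k-1)}(\nu_x,\nu_{k+1},\dots,\nu_n)}{\mathcal H_{k-1}\big(B^{(k-1)}(\nu_x,\nu_{k+1},\dots,\nu_n)\big)}\,d\mathcal H_{k-1}(x),$$ where $\nu_x\in\{\nu_{k+1},\dots,\nu_n\}^\perp$ is the outward unit normal to $\partial B^{(k)}(\nu_{k+1},\dots,\nu_n)$ at $x$ (it exists and is unique for $\mathcal H_{k-1}$-almost every $x$), $\mathcal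 H_{k-1}$ is the $(k-1)$-dimensional Euclidean Hausdorff measure, and values are taken in $[0,\infty]$. (If $B$ is unbounded, a quotient with infinite denominator is read as $0$.) The self-volume of $B$ is $\omega^{(n)}(B):=\omega^{(n)}_B$, the value for $k=n$ and the empty frame. Then for every invertible affine map $T:\mathbb R^n\to\mathbb R^n$ with $T(0)=0$, $$\omega^{(n)}(T(B))=\omega^{(n)}(B).$$ -/

import Mathlib

open scoped ENNReal InnerProductSpace MeasureTheory

noncomputable section

namespace SelfPerimeter

variable {n : ℕ}

/-- The subspace of `ℝⁿ` orthogonal to all the vectors of the frame `F`. -/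
def frameSpace (F : List (EuclideanSpace ℝ (Fin n))) :
    Submodule ℝ (EuclideanSpace ℝ (Fin n)) :=
  (Submodule.span ℝ {v | v ∈ F})ᗮ

/-- The central section of `B` by the subspace orthogonal to the frame `F`. -/
def centralSection (B : Set (EuclideanSpace ℝ (Fin n)))
    (F : List (EuclideanSpace ℝ (Fin n))) : Set (EuclideanSpace ℝ (Fin n)) :=
  B ∩ frameSpace F

/-- The boundary of the central section, taken relative to the subspace orthogonal to `F`. -/
def sectionBoundary (B : Set (EuclideanSpace ℝ (Fin n)))
    (F : List (EuclideanSpace ℝ (Fin n))) : Set (EuclideanSpace ℝ (Fin n)) :=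
  ((↑) : frameSpace F → EuclideanSpace ℝ (Fin n)) ''
    frontier (((↑) : frameSpace F → EuclideanSpace ℝ (Fin n)) ⁻¹' B)

/-- `ν` is an outward unit normal, within the subspace orthogonal to `F`, to the central section
of `B` at its boundary point `x`. -/
def IsUnitNormal (B : Set (EuclideanSpace ℝ (Fin n))) (F : List (EuclideanSpace ℝ (Fin n)))
    (x ν : EuclideanSpace ℝ (Fin n)) : Prop :=
  ν ∈ frameSpace F ∧ ‖ν‖ = 1 ∧ ∀ y ∈ centralSection B F, ⟪ν, y - x⟫_ℝ ≤ 0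

open Classical in
/-- The outward unit normal to the central section of `B` at the boundary point `x`. For a convex
`B` with `0` in its interior it exists and is unique at almost every boundary point with respect
to surface measure; at the exceptional points, where several normals exist, the value is `0`. -/
def unitNormal (B : Set (EuclideanSpace ℝ (Fin n))) (F : List (EuclideanSpace ℝ (Fin n)))
    (x : EuclideanSpace ℝ (Fin n)) : EuclideanSpace ℝ (Fin n) :=
  if h : ∃! ν, IsUnitNormal B F x ν then h.choose else 0

/-- The `k`-dimensional self-volume of the central section of `B` orthogonal to the frame `F`
(which consists of `n - k` orthonormal vectors). It is `2` in dimension one. In dimension `k ≥ 2`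
it is `1 / k` times the integral over the boundary of the section of the ratio between the
self-volume and the Euclidean volume of the parallel central hyperplane section.
`μHE[d]` is the `d`-dimensional Hausdorff measure, normalized so that it is Lebesgue measure on
`d`-dimensional Euclidean spaces. The value `1` in dimension zero is a convention. -/
def frameSelfVolume (B : Set (EuclideanSpace ℝ (Fin n))) :
    ℕ → List (EuclideanSpace ℝ (Fin n)) → ℝ≥0∞
  | 0, _ => 1
  | 1, _ => 2
  | k + 2, F => ((k + 2 : ℕ) : ℝ≥0∞)⁻¹ *
      ∫⁻ x in sectionBoundary B F,
        frameSelfVolume B (k + 1) (unitNormal B F x :: F) /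
          μHE[k + 1] (centralSection B (unitNormal B F x :: F)) ∂μHE[k + 1]

/-- The self-volume of `B ⊆ ℝⁿ`: no vectors in the frame, the section is `B` itself. -/
def selfVolume (B : Set (EuclideanSpace ℝ (Fin n))) : ℝ≥0∞ :=
  frameSelfVolume B n []

end SelfPerimeter

end

/-! Near a boundary point x with unique normal ν, T scales surface measure by nearly its Jacobian J
on the tangent hyperplane orthogonal to ν. The denominator of the integrand is the volume of the
central section parallel to that hyperplane, so T scales it by exactly J, and the numerator is
unchanged by induction on dimension. The two factors cancel.

No area formula or almost-everywhere differentiability is needed. Where the normal is unique,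
normals at nearby points are close to it (`eventually_isUnitNormal_dist_lt`), so nearby chords of
the boundary are almost tangent and T distorts measure by J up to a power of ρ > 1
(`exists_subspaceJacobian_bounds`). A countable cover turns this into an inequality of integrals up
to a power of ρ (`setLIntegral_image_le_of_locally`); then ρ → 1, and T⁻¹ gives the reverse
inequality.

Points without a unique normal need no null-set argument: there `unitNormal` is 0, the section keeps
its full dimension, its measure in one dimension less is infinite, and the integrand vanishes. -/

open scoped ENNReal InnerProductSpace MeasureTheory

open MeasureTheory Measure Module Set Topology
open scoped NNReal

/-! ### Distortion of Hausdorff measure by linear maps -/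

section HausdorffComparison

/-- On `A`, equal values of `g` force equal values of `f`, so `f` factors through `g` by a
`K`-Lipschitz map on `g '' A`. -/
theorem euclideanHausdorffMeasure_image_le_of_edist_le {α X Y : Type*}
    [EMetricSpace X] [MeasurableSpace X] [BorelSpace X]
    [EMetricSpace Y] [MeasurableSpace Y] [BorelSpace Y]
    (d : ℕ) {f : α → X} {g : α → Y} {A : Set α} {K : ℝ≥0}
    (h : ∀ y ∈ A, ∀ z ∈ A, edist (f y) (f z) ≤ K * edist (g y) (g z)) :
    μHE[d] (f '' A) ≤ (K : ℝ≥0∞) ^ d * μHE[d] (g '' A) := by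
  rcases A.eq_empty_or_nonempty with rfl | ⟨a, ha⟩
  · simp
  have : Nonempty α := ⟨a⟩
  have hinv : ∀ y ∈ A, f (Function.invFunOn g A (g y)) = f y := by
    intro y hy
    have h1 := Function.invFunOn_mem (f := g) (s := A) ⟨y, hy, rfl⟩
    have h2 := Function.invFunOn_eq (f := g) (s := A) ⟨y, hy, rfl⟩
    have h3 := h _ h1 _ hy
    rw [h2, edist_self, mul_zero] at h3
    exact edist_le_zero.1 h3
  have hlip : LipschitzOnWith K (fun w => f (Function.invFunOn g A w)) (g '' A) := by
    rintro _ ⟨y, hy, rfl⟩ _ ⟨z, hz, rfl⟩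
    simp only [hinv y hy, hinv z hz]
    exact h y hy z hz
  have himg : (fun w => f (Function.invFunOn g A w)) '' (g '' A) = f '' A := by
    rw [image_image]
    exact image_congr hinv
  have := hlip.hausdorffMeasure_image_le (d := d) (Nat.cast_nonneg d)
  rw [himg, ENNReal.rpow_natCast] at this
  simp only [euclideanHausdorffMeasure_def, Measure.smul_apply, Measure.nnreal_smul_coe_apply]
  rw [mul_left_comm]
  gcongr

variable {V : Type*} [NormedAddCommGroup V] [InnerProductSpace ℝ V] [FiniteDimensional ℝ V]
  [MeasurableSpace V] [BorelSpace V]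

/-- The factor by which an invertible linear map scales Euclidean measure on a subspace. -/
noncomputable def subspaceJacobian (T : V ≃L[ℝ] V) (W : Submodule ℝ V) : ℝ≥0∞ :=
  ENNReal.ofReal ((T : V →ₗ[ℝ] V).domRestrict W).normDet

omit [MeasurableSpace V] [BorelSpace V] in
theorem subspaceJacobian_ne_top (T : V ≃L[ℝ] V) (W : Submodule ℝ V) :
    subspaceJacobian T W ≠ ∞ := ENNReal.ofReal_ne_top

omit [MeasurableSpace V] [BorelSpace V] in
theorem subspaceJacobian_ne_zero (T : V ≃L[ℝ] V) (W : Submodule ℝ V) :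
    subspaceJacobian T W ≠ 0 := by
  have h : ((T : V →ₗ[ℝ] V).domRestrict W).normDet ≠ 0 := by
    refine (LinearMap.normDet_ne_zero_tfae _).out 0 4 |>.2 ?_
    intro a b hab
    exact Subtype.ext (T.injective hab)
  have h' := (LinearMap.normDet_nonneg ((T : V →ₗ[ℝ] V).domRestrict W)).lt_of_ne' h
  simpa [subspaceJacobian] using h'

theorem euclideanHausdorffMeasure_image_of_subset (T : V ≃L[ℝ] V) (W : Submodule ℝ V)
    {A : Set V} (hA : A ⊆ W) :
    μHE[finrank ℝ W] (T '' A) = subspaceJacobian T W * μHE[finrank ℝ W] A := by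
  have h := ((T : V →ₗ[ℝ] V).domRestrict W).euclideanHausdorffMeasure_image
    ((↑) ⁻¹' A : Set W)
  have hA' : ((↑) : W → V) '' ((↑) ⁻¹' A : Set W) = A := by
    exact (Subtype.image_preimage_coe (W : Set V) A).trans (inter_eq_right.2 hA)
  have h2 : μHE[finrank ℝ W] ((↑) ⁻¹' A : Set W) = μHE[finrank ℝ W] A := by
    rw [← W.subtypeₗᵢ.isometry.euclideanHausdorffMeasure_image]
    exact congrArg _ hA'
  rw [h2] at h
  rw [subspaceJacobian, ← h, ← hA', image_image, hA']
  rfl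

theorem ContinuousLinearEquiv.exists_norm_le_of_norm_sub_le {E : Type*} [NormedAddCommGroup E]
    [NormedSpace ℝ E] (T : E ≃L[ℝ] E) {ρ : ℝ≥0} (hρ : 1 < ρ) :
    ∃ δ > 0, ∀ v w : E, ‖v - w‖ ≤ δ * ‖v‖ →
      ‖T v‖ ≤ ρ * ‖T w‖ ∧ ‖T w‖ ≤ ρ * ‖T v‖ ∧ ‖v‖ ≤ ρ * ‖w‖ := by
  have hρ' : (1 : ℝ) < ρ := by exact_mod_cast hρ
  obtain ⟨M, hM0, hM⟩ := (T : E →L[ℝ] E).bound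
  obtain ⟨N, hN0, hN⟩ := (T.symm : E →L[ℝ] E).bound
  have hM' : ∀ v, ‖T v‖ ≤ M * ‖v‖ := hM
  have hN' : ∀ v, ‖v‖ ≤ N * ‖T v‖ := fun v => by simpa using hN (T v)
  set C := 2 * (M * N + 1) with hC
  have hMN : 0 < M * N := mul_pos hM0 hN0
  have hC0 : 0 < C := by positivity
  -- The bound 1/2 gives ‖v‖ ≤ 2‖w‖; the other absorbs M * N, which bounds the condition number of
  -- T.
  refine ⟨min (1 / 2) ((ρ - 1) / C), lt_min (by norm_num) (div_pos (by linarith) hC0), ?_⟩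
  intro v w h
  set δ := min (1 / 2 : ℝ) ((ρ - 1) / C)
  have hδ0 : 0 < δ := lt_min (by norm_num) (div_pos (by linarith) hC0)
  have hδ1 : δ ≤ 1 / 2 := min_le_left _ _
  have hδ2 : δ * C ≤ ρ - 1 := by
    rw [← le_div_iff₀ hC0]; exact min_le_right _ _
  have hvw : ‖v‖ ≤ ‖w‖ + ‖v - w‖ := by
    simpa using norm_add_le w (v - w)
  have hv2 : ‖v‖ ≤ 2 * ‖w‖ := by nlinarith [norm_nonneg v]
  have hTvw : ‖T (v - w)‖ ≤ M * (δ * ‖v‖) := (hM' _).trans (by gcongr)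
  have h1 : ‖T v‖ ≤ ‖T w‖ + ‖T (v - w)‖ := by
    simpa [map_sub] using norm_add_le (T w) (T (v - w))
  have h2 : ‖T w‖ ≤ ‖T v‖ + ‖T (v - w)‖ := by
    simpa [map_sub] using norm_sub_le (T v) (T (v - w))
  have hMN2 : δ * (2 * (M * N)) ≤ ρ - 1 := le_trans (by gcongr; rw [hC]; linarith) hδ2
  refine ⟨?_, ?_, ?_⟩
  · have : M * (δ * ‖v‖) ≤ δ * (2 * (M * N)) * ‖T w‖ := by
      calc M * (δ * ‖v‖) ≤ M * (δ * (2 * (N * ‖T w‖))) := by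
            gcongr; exact hv2.trans (by gcongr; exact hN' w)
        _ = _ := by ring
    nlinarith [norm_nonneg (T w)]
  · have : M * (δ * ‖v‖) ≤ δ * (2 * (M * N)) * ‖T v‖ := by
      calc M * (δ * ‖v‖) ≤ M * (δ * (N * ‖T v‖)) := by
            gcongr; exact hN' v
        _ ≤ M * (δ * (2 * (N * ‖T v‖))) := by
            have := mul_nonneg hN0.le (norm_nonneg (T v))
            have : N * ‖T v‖ ≤ 2 * (N * ‖T v‖) := by linarith
            gcongr
        _ = _ := by ring
    nlinarith [norm_nonneg (T v)]
  · have : δ * 2 ≤ ρ - 1 := le_trans (by gcongr; rw [hC]; linarith) hδ2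
    nlinarith [norm_nonneg w]

/-- A set all of whose chords make a small angle with a subspace `W` is scaled by a linear map
by nearly the same factor as subsets of `W`. -/
theorem exists_subspaceJacobian_bounds (T : V ≃L[ℝ] V) {ρ : ℝ≥0} (hρ : 1 < ρ) :
    ∃ δ > 0, ∀ (W : Submodule ℝ V) (A : Set V),
      (∀ y ∈ A, ∀ z ∈ A, ‖(y - z) - W.starProjection (y - z)‖ ≤ δ * ‖y - z‖) →
      μHE[finrank ℝ W] (T '' A) ≤
          (ρ : ℝ≥0∞) ^ finrank ℝ W * (subspaceJacobian T W * μHE[finrank ℝ W] A) ∧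
        subspaceJacobian T W * μHE[finrank ℝ W] A ≤
          (ρ : ℝ≥0∞) ^ (2 * finrank ℝ W) * μHE[finrank ℝ W] (T '' A) := by
  obtain ⟨δ, hδ, H⟩ := T.exists_norm_le_of_norm_sub_le hρ
  refine ⟨δ, hδ, fun W A hA => ?_⟩
  have key : ∀ {a b c : V} {e : V} {K : ℝ≥0}, ‖a - b‖ ≤ K * ‖c - e‖ →
      edist a b ≤ K * edist c e := by
    intro a b c e K h
    rw [edist_nndist, edist_nndist, ← ENNReal.coe_mul, ENNReal.coe_le_coe]
    rw [← NNReal.coe_le_coe]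
    simpa [dist_eq_norm] using h
  -- On `A` the projection to `W` nearly preserves lengths, both before and after applying T. The
  -- projected set lies in `W`, where the scaling is exact.
  have e1 : μHE[finrank ℝ W] (T '' A) ≤
      (ρ : ℝ≥0∞) ^ finrank ℝ W * μHE[finrank ℝ W] ((fun v => T (W.starProjection v)) '' A) :=
    euclideanHausdorffMeasure_image_le_of_edist_le _ fun y hy z hz => key <| by
      simpa only [map_sub] using (H _ _ (hA y hy z hz)).1
  have e2 : μHE[finrank ℝ W] ((fun v => T (W.starProjection v)) '' A) ≤
      (ρ : ℝ≥0∞) ^ finrank ℝ W * μHE[finrank ℝ W] (T '' A) :=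
    euclideanHausdorffMeasure_image_le_of_edist_le _ fun y hy z hz => key <| by
      simpa only [map_sub] using (H _ _ (hA y hy z hz)).2.1
  have e3 : μHE[finrank ℝ W] ((fun v => v) '' A) ≤
      (ρ : ℝ≥0∞) ^ finrank ℝ W * μHE[finrank ℝ W] (W.starProjection '' A) :=
    euclideanHausdorffMeasure_image_le_of_edist_le _ fun y hy z hz => key <| by
      simpa only [map_sub] using (H _ _ (hA y hy z hz)).2.2
  have e4 : μHE[finrank ℝ W] (W.starProjection '' A) ≤
      ((1 : ℝ≥0) : ℝ≥0∞) ^ finrank ℝ W * μHE[finrank ℝ W] ((fun v => v) '' A) :=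
    euclideanHausdorffMeasure_image_le_of_edist_le _ fun y hy z hz => key <| by
      simpa only [map_sub, NNReal.coe_one, one_mul] using W.norm_starProjection_apply_le (y - z)
  have e5 : μHE[finrank ℝ W] ((fun v => T (W.starProjection v)) '' A) =
      subspaceJacobian T W * μHE[finrank ℝ W] (W.starProjection '' A) := by
    rw [← euclideanHausdorffMeasure_image_of_subset T W, image_image]
    rintro _ ⟨y, -, rfl⟩
    exact W.starProjection_apply_mem y
  rw [image_id'] at e3 e4
  rw [ENNReal.coe_one, one_pow, one_mul] at e4
  rw [e5] at e1 e2
  constructor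
  · exact e1.trans (by gcongr)
  · calc _ ≤ subspaceJacobian T W * ((ρ : ℝ≥0∞) ^ finrank ℝ W *
          μHE[finrank ℝ W] (W.starProjection '' A)) := by gcongr
      _ = (ρ : ℝ≥0∞) ^ finrank ℝ W * (subspaceJacobian T W *
          μHE[finrank ℝ W] (W.starProjection '' A)) := by ring
      _ ≤ (ρ : ℝ≥0∞) ^ finrank ℝ W * ((ρ : ℝ≥0∞) ^ finrank ℝ W * μHE[finrank ℝ W] (T '' A)) := by
          gcongr
      _ = _ := by ring

/-- The unit ball of `W'` is scaled exactly by the Jacobian of `W'`, and nearly by that of `W`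
because its chords are almost parallel to `W`. Its measure is positive and finite, hence cancels. -/
theorem exists_subspaceJacobian_le (T : V ≃L[ℝ] V) {ρ : ℝ≥0} (hρ : 1 < ρ) :
    ∃ δ > 0, ∀ W W' : Submodule ℝ V, finrank ℝ W = finrank ℝ W' →
      (∀ v ∈ W', ‖v - W.starProjection v‖ ≤ δ * ‖v‖) →
      subspaceJacobian T W ≤ (ρ : ℝ≥0∞) ^ (2 * finrank ℝ W) * subspaceJacobian T W' := by
  obtain ⟨δ, hδ, H⟩ := exists_subspaceJacobian_bounds T hρ
  refine ⟨δ, hδ, fun W W' hWW' h => ?_⟩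
  set A : Set V := (↑) '' (Metric.closedBall (0 : W') 1) with hA
  have hAW : A ⊆ W' := by rintro _ ⟨v, -, rfl⟩; exact v.2
  have h1 := (H W A fun y hy z hz => h _ (W'.sub_mem (hAW hy) (hAW hz))).2
  rw [hWW', euclideanHausdorffMeasure_image_of_subset T W' hAW, ← mul_assoc] at h1
  have h2 : μHE[finrank ℝ W'] A = volume (Metric.closedBall (0 : W') 1) := by
    refine (W'.subtypeₗᵢ.isometry.euclideanHausdorffMeasure_image _).trans ?_
    exact congrArg (fun μ => μ (Metric.closedBall (0 : W') 1))
      InnerProductSpace.euclideanHausdorffMeasure_eq_volume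
  have h3 : μHE[finrank ℝ W'] A ≠ 0 := by
    rw [h2]; exact (Metric.measure_closedBall_pos _ _ one_pos).ne'
  have h4 : μHE[finrank ℝ W'] A ≠ ∞ := by
    rw [h2]; exact measure_closedBall_lt_top.ne
  rw [hWW']
  exact (ENNReal.mul_le_mul_iff_left h3 h4).1 h1

end HausdorffComparison

/-! ### Globalizing a local comparison of integrals -/

/-- A comparison of integrals under a homeomorphism which locally, near the points where the
integrand does not vanish, distorts the measure and the integrand by nearly inverse factors.
Neither integrand has to be measurable. -/
theorem setLIntegral_image_le_of_locally {X Y : Type*}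
    [TopologicalSpace X] [SecondCountableTopology X] [MeasurableSpace X] [BorelSpace X]
    [TopologicalSpace Y] [MeasurableSpace Y] [BorelSpace Y]
    (e : X ≃ₜ Y) (μ : Measure X) (ν : Measure Y) {S : Set X} (hS : MeasurableSet S)
    (f : X → ℝ≥0∞) (g : Y → ℝ≥0∞) {K : ℝ≥0∞} (hK : K ≠ ∞)
    (h : ∀ x ∈ S, g (e x) ≠ 0 → ∃ c : ℝ≥0∞, ∃ U : Set X, IsOpen U ∧ x ∈ U ∧
      (∀ A ⊆ U ∩ S, ν (e '' A) ≤ K * (c * μ A)) ∧ ∀ y ∈ U ∩ S, c * g (e y) ≤ K * f y) :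
    ∫⁻ y in e '' S, g y ∂ν ≤ K * K * ∫⁻ x in S, f x ∂μ := by
  choose! c U hUo hxU hmeas hfun using h
  set R : Set X := {x | x ∈ S ∧ g (e x) ≠ 0} with hR
  obtain ⟨t, htR, htc, hRt⟩ := TopologicalSpace.countable_cover_nhdsWithin (s := R) (f := U)
    fun x hx => mem_nhdsWithin_of_mem_nhds ((hUo x hx.1 hx.2).mem_nhds (hxU x hx.1 hx.2))
  let em : X ≃ᵐ Y := e.toMeasurableEquiv
  set μ' : Measure X := ν.map em.symm with hμ'
  have hνμ' : ν = μ'.map em := by simp [hμ']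
  have hμ'A : ∀ A : Set X, μ' A = ν (e '' A) := fun A => by
    rw [hμ', em.symm.map_apply, ← em.image_eq_preimage_symm]
    rfl
  have hint : ∫⁻ y in e '' S, g y ∂ν = ∫⁻ x in S, g (e x) ∂μ' := by
    rw [hνμ', em.restrict_map, lintegral_map_equiv]
    have : em ⁻¹' (e '' S) = S := e.injective.preimage_image S
    rw [this]
    rfl
  have hlocal : ∀ x ∈ R, ∀ W : Set X, MeasurableSet W → W ⊆ U x →
      ∫⁻ y in S ∩ W, g (e y) ∂μ' ≤ K * K * ∫⁻ y in S ∩ W, f y ∂μ := by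
    intro x hx W hW hWU
    have hle : μ'.restrict (S ∩ W) ≤ (K * c x) • μ.restrict (S ∩ W) := by
      refine Measure.le_iff.2 fun A hA => ?_
      rw [Measure.smul_apply, Measure.restrict_apply hA, Measure.restrict_apply hA, hμ'A,
        smul_eq_mul, mul_assoc]
      exact hmeas x hx.1 hx.2 _ fun y hy => ⟨hWU hy.2.2, hy.2.1⟩
    calc ∫⁻ y in S ∩ W, g (e y) ∂μ' ≤ ∫⁻ y, g (e y) ∂((K * c x) • μ.restrict (S ∩ W)) :=
          lintegral_mono' hle le_rfl
      _ = K * (c x * ∫⁻ y in S ∩ W, g (e y) ∂μ) := by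
          rw [lintegral_smul_measure, smul_eq_mul, mul_assoc]
      _ ≤ K * ∫⁻ y in S ∩ W, c x * g (e y) ∂μ := by
          gcongr; exact lintegral_const_mul_le _ _
      _ ≤ K * ∫⁻ y in S ∩ W, K * f y ∂μ := by
          gcongr 1
          exact setLIntegral_mono' (hS.inter hW) fun y hy => hfun x hx.1 hx.2 y ⟨hWU hy.2, hy.1⟩
      _ ≤ K * (K * ∫⁻ y in S ∩ W, f y ∂μ) := by
          rw [lintegral_const_mul' _ _ hK]
      _ = _ := by rw [mul_assoc]
  rw [hint]
  rcases t.eq_empty_or_nonempty with rfl | htne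
  · have : ∫⁻ x in S, g (e x) ∂μ' = 0 := by
      refine (setLIntegral_congr_fun hS fun x hx => ?_).trans lintegral_zero
      by_contra hne
      simpa using hRt (⟨hx, hne⟩ : x ∈ R)
    simp [this]
  obtain ⟨s, rfl⟩ := htc.exists_eq_range htne
  have hsR : ∀ i, s i ∈ R := fun i => htR ⟨i, rfl⟩
  -- Disjoint measurable pieces let the integrals of `f` add up exactly; on the `g` side
  -- subadditivity is enough.
  set W := disjointed fun i => U (s i)
  have hWm : ∀ i, MeasurableSet (W i) := fun i =>
    MeasurableSet.disjointed (fun i => (hUo _ (hsR i).1 (hsR i).2).measurableSet) i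
  have hRW : R ⊆ ⋃ i, W i := by
    rw [iUnion_disjointed]
    simpa using hRt
  have hWd : Pairwise (Function.onFun Disjoint fun i => S ∩ W i) := fun i j hij =>
    (disjoint_disjointed _ hij).mono inter_subset_right inter_subset_right
  calc ∫⁻ x in S, g (e x) ∂μ'
      ≤ ∫⁻ x in (⋃ i, S ∩ W i) ∪ (S \ ⋃ i, W i), g (e x) ∂μ' := by
        rw [← inter_iUnion, inter_union_sdiff]
    _ ≤ ∫⁻ x in ⋃ i, S ∩ W i, g (e x) ∂μ' + ∫⁻ x in S \ ⋃ i, W i, g (e x) ∂μ' :=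
        lintegral_union_le _ _ _
    _ = ∫⁻ x in ⋃ i, S ∩ W i, g (e x) ∂μ' + 0 := by
        congr 1
        refine (setLIntegral_congr_fun (hS.diff (.iUnion hWm)) fun x hx => ?_).trans lintegral_zero
        by_contra hne
        exact hx.2 (hRW ⟨hx.1, hne⟩)
    _ ≤ ∑' i, ∫⁻ x in S ∩ W i, g (e x) ∂μ' := by
        rw [add_zero]; exact lintegral_iUnion_le _ _
    _ ≤ ∑' i, K * K * ∫⁻ x in S ∩ W i, f x ∂μ :=
        ENNReal.tsum_le_tsum fun i => hlocal _ (hsR i) _ (hWm i) (disjointed_subset _ i)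
    _ = K * K * ∫⁻ x in ⋃ i, S ∩ W i, f x ∂μ := by
        rw [ENNReal.tsum_mul_left, lintegral_iUnion (fun i => hS.inter (hWm i)) hWd]
    _ ≤ K * K * ∫⁻ x in S, f x ∂μ := by
        gcongr
        exact iUnion_subset fun i => inter_subset_left

namespace SelfPerimeter

variable {n : ℕ} {B : Set (EuclideanSpace ℝ (Fin n))} {F F' : List (EuclideanSpace ℝ (Fin n))}
  {x ν : EuclideanSpace ℝ (Fin n)}

/-! ### Orthogonal complements of frames -/

section Frames

theorem mem_frameSpace_cons {v : EuclideanSpace ℝ (Fin n)} :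
    v ∈ frameSpace (ν :: F) ↔ ⟪ν, v⟫_ℝ = 0 ∧ v ∈ frameSpace F := by
  have h : {v | v ∈ ν :: F} = {ν} ∪ {v | v ∈ F} := by ext; simp
  rw [frameSpace, frameSpace, h, Submodule.span_union, ← Submodule.inf_orthogonal,
    Submodule.mem_inf, Submodule.mem_orthogonal_singleton_iff_inner_right]

theorem frameSpace_zero_cons : frameSpace (0 :: F) = frameSpace F := by
  ext v; simp [mem_frameSpace_cons]

theorem frameSpace_nil : frameSpace ([] : List (EuclideanSpace ℝ (Fin n))) = ⊤ := by
  simp [frameSpace]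

theorem starProjection_frameSpace_cons (hν : ν ∈ frameSpace F) (h1 : ‖ν‖ = 1)
    {v : EuclideanSpace ℝ (Fin n)} (hv : v ∈ frameSpace F) :
    (frameSpace (ν :: F)).starProjection v = v - ⟪ν, v⟫_ℝ • ν := by
  refine Submodule.eq_starProjection_of_mem_orthogonal ?_ ?_
  · rw [mem_frameSpace_cons]
    refine ⟨?_, Submodule.sub_mem _ hv (Submodule.smul_mem _ _ hν)⟩
    rw [inner_sub_right, inner_smul_right, real_inner_self_eq_norm_sq, h1]
    ring
  · rw [sub_sub_cancel]
    refine Submodule.smul_mem _ _ ?_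
    rw [Submodule.mem_orthogonal']
    exact fun u hu => (mem_frameSpace_cons.1 hu).1

theorem norm_sub_starProjection_frameSpace_cons (hν : ν ∈ frameSpace F) (h1 : ‖ν‖ = 1)
    {v : EuclideanSpace ℝ (Fin n)} (hv : v ∈ frameSpace F) :
    ‖v - (frameSpace (ν :: F)).starProjection v‖ = |⟪ν, v⟫_ℝ| := by
  rw [starProjection_frameSpace_cons hν h1 hv, sub_sub_cancel, norm_smul, h1, mul_one,
    Real.norm_eq_abs]

theorem finrank_frameSpace_cons (hν : ν ∈ frameSpace F) (h1 : ‖ν‖ = 1) :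
    finrank ℝ (frameSpace (ν :: F)) + 1 = finrank ℝ (frameSpace F) := by
  set f : frameSpace F →ₗ[ℝ] ℝ := (innerₗ _ ν).domRestrict (frameSpace F) with hf
  have hfv : ∀ v : frameSpace F, f v = ⟪ν, (v : EuclideanSpace ℝ (Fin n))⟫_ℝ := fun v => rfl
  have hsurj : f.range = ⊤ := by
    refine LinearMap.range_eq_top.2 fun c => ⟨c • ⟨ν, hν⟩, ?_⟩
    rw [map_smul, hfv, real_inner_self_eq_norm_sq, h1]
    simp
  have hker : f.ker.map (frameSpace F).subtype = frameSpace (ν :: F) := by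
    ext v
    simp [mem_frameSpace_cons, hfv]
  rw [← f.finrank_range_add_finrank_ker, hsurj, ← hker, Submodule.finrank_map_subtype_eq,
    finrank_top, finrank_self, add_comm]

end Frames

/-! ### Normals to convex sections -/

section Normals

theorem sectionBoundary_subset_frameSpace : sectionBoundary B F ⊆ frameSpace F := by
  rintro _ ⟨v, -, rfl⟩; exact v.2

theorem isClosed_sectionBoundary : IsClosed (sectionBoundary B F) :=
  (frameSpace F).closed_of_finiteDimensional.isClosedEmbedding_subtypeVal.isClosedMap _
    isClosed_frontier

theorem sectionBoundary_subset_closure : sectionBoundary B F ⊆ closure (centralSection B F) := by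
  rintro _ ⟨v, hv, rfl⟩
  have h := image_closure_subset_closure_image (continuous_subtype_val)
    (mem_image_of_mem _ (frontier_subset_closure hv))
  refine closure_mono ?_ h
  rintro _ ⟨w, hw, rfl⟩
  exact ⟨hw, w.2⟩

theorem IsUnitNormal.inner_sub_nonpos (h : IsUnitNormal B F x ν) {y : EuclideanSpace ℝ (Fin n)}
    (hy : y ∈ sectionBoundary B F) : ⟪ν, y - x⟫_ℝ ≤ 0 := by
  have hcl : IsClosed {y : EuclideanSpace ℝ (Fin n) | ⟪ν, y - x⟫_ℝ ≤ 0} :=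
    isClosed_le (by fun_prop) continuous_const
  exact closure_minimal (fun y hy => h.2.2 y hy) hcl (sectionBoundary_subset_closure hy)

theorem zero_mem_interior_preimage (h0 : (0 : EuclideanSpace ℝ (Fin n)) ∈ interior B) :
    (0 : frameSpace F) ∈ interior (((↑) : frameSpace F → EuclideanSpace ℝ (Fin n)) ⁻¹' B) :=
  preimage_interior_subset_interior_preimage continuous_subtype_val h0

theorem isUnitNormal_inv_norm_smul {w : EuclideanSpace ℝ (Fin n)} (hw : w ∈ frameSpace F)
    (hw0 : w ≠ 0) (h : ∀ y ∈ centralSection B F, ⟪w, y - x⟫_ℝ ≤ 0) :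
    IsUnitNormal B F x (‖w‖⁻¹ • w) := by
  refine ⟨Submodule.smul_mem _ _ hw, norm_smul_inv_norm hw0, fun y hy => ?_⟩
  rw [real_inner_smul_left]
  exact mul_nonpos_of_nonneg_of_nonpos (by positivity) (h y hy)

theorem exists_isUnitNormal (hB : Convex ℝ B)
    (h0 : (0 : EuclideanSpace ℝ (Fin n)) ∈ interior B) (hx : x ∈ sectionBoundary B F) :
    ∃ ν, IsUnitNormal B F x ν := by
  obtain ⟨v, hv, rfl⟩ := hx
  set C : Set (frameSpace F) := ((↑) : frameSpace F → EuclideanSpace ℝ (Fin n)) ⁻¹' B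
  have hC : Convex ℝ C := hB.linear_preimage (frameSpace F).subtype
  have h0C : (0 : frameSpace F) ∈ interior C := zero_mem_interior_preimage h0
  obtain ⟨f, hf⟩ := geometric_hahn_banach_open_point hC.interior isOpen_interior hv.2
  obtain ⟨w, rfl⟩ := (InnerProductSpace.toDual ℝ (frameSpace F)).surjective f
  simp only [InnerProductSpace.toDual_apply_apply] at hf
  have hw0 : (w : EuclideanSpace ℝ (Fin n)) ≠ 0 := by
    intro hw
    have := hf 0 h0C
    rw [show w = 0 from Subtype.ext hw] at this
    simp at this
  refine ⟨_, isUnitNormal_inv_norm_smul w.2 hw0 fun y hy => ?_⟩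
  have hcl : IsClosed {y : frameSpace F | ⟪w, y⟫_ℝ ≤ ⟪w, v⟫_ℝ} :=
    isClosed_le (by fun_prop) continuous_const
  have hyC : (⟨y, hy.2⟩ : frameSpace F) ∈ closure (interior C) := by
    rw [hC.closure_interior_eq_closure_of_nonempty_interior ⟨0, h0C⟩]
    exact subset_closure hy.1
  have := closure_minimal (fun y hy => (hf y hy).le) hcl hyC
  rw [inner_sub_right, sub_nonpos]
  exact this

/-- The set-valued map sending a point to its normals is upper semicontinuous. -/
theorem eventually_isUnitNormal_dist_lt (hν : ∀ ν', IsUnitNormal B F x ν' → ν' = ν) {δ : ℝ}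
    (hδ : 0 < δ) : ∀ᶠ y in 𝓝 x, ∀ ν', IsUnitNormal B F y ν' → ‖ν' - ν‖ < δ := by
  -- Unit vectors at distance at least δ from ν form a compact set, and failing to be a normal is an
  -- open condition on the pair (point, vector).
  have hK : IsCompact (Metric.sphere (0 : EuclideanSpace ℝ (Fin n)) 1 \ Metric.ball ν δ) :=
    (isCompact_sphere _ _).diff Metric.isOpen_ball
  have key := hK.eventually_forall_of_forall_eventually (x₀ := x)
    (P := fun y ν' => ¬ IsUnitNormal B F y ν') ?_
  · filter_upwards [key] with y hy ν' hν'
    by_contra hlt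
    refine hy ν' ⟨by simp [hν'.2.1], ?_⟩ hν'
    simpa [dist_eq_norm] using hlt
  · intro ν' hν'
    have hne : ¬ IsUnitNormal B F x ν' := by
      intro h
      exact hν'.2 (by rw [hν ν' h]; exact Metric.mem_ball_self hδ)
    by_cases hF : ν' ∈ frameSpace F
    · have h1 : ‖ν'‖ = 1 := by simpa using hν'.1
      obtain ⟨z, hz, hpos⟩ : ∃ z ∈ centralSection B F, 0 < ⟪ν', z - x⟫_ℝ := by
        by_contra! hcon
        exact hne ⟨hF, h1, hcon⟩
      have hopen : IsOpen {p : EuclideanSpace ℝ (Fin n) × EuclideanSpace ℝ (Fin n) |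
          0 < ⟪p.2, z - p.1⟫_ℝ} := isOpen_lt continuous_const (by fun_prop)
      filter_upwards [hopen.mem_nhds hpos] with p hp hn
      exact (hn.2.2 z hz).not_gt hp
    · have hopen : IsOpen {p : EuclideanSpace ℝ (Fin n) × EuclideanSpace ℝ (Fin n) |
          p.2 ∉ frameSpace F} :=
        (frameSpace F).closed_of_finiteDimensional.isOpen_compl.preimage continuous_snd
      filter_upwards [hopen.mem_nhds hF] with p hp hn
      exact hp hn.1

/-- Each of `y`, `z` lies in the supporting half-space of the other, so ⟪ν₁, y - z⟫ ≥ 0 ≥ ⟪ν₂, y -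
z⟫; replacing both normals by ν costs at most δ‖y - z‖. -/
theorem abs_inner_sub_le_of_isUnitNormal {y z ν₁ ν₂ : EuclideanSpace ℝ (Fin n)} {δ : ℝ}
    (hy : y ∈ sectionBoundary B F) (hz : z ∈ sectionBoundary B F)
    (h₁ : IsUnitNormal B F y ν₁) (h₂ : IsUnitNormal B F z ν₂)
    (hδ₁ : ‖ν₁ - ν‖ < δ) (hδ₂ : ‖ν₂ - ν‖ < δ) : |⟪ν, y - z⟫_ℝ| ≤ δ * ‖y - z‖ := by
  have e₁ := h₁.inner_sub_nonpos hz
  have e₂ := h₂.inner_sub_nonpos hy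
  have c₁ := (real_inner_le_norm (ν₁ - ν) (y - z))
  have c₂ := (neg_le_of_abs_le (abs_real_inner_le_norm (ν₂ - ν) (y - z)))
  have m₁ : ‖ν₁ - ν‖ * ‖y - z‖ ≤ δ * ‖y - z‖ := by gcongr
  have m₂ : ‖ν₂ - ν‖ * ‖y - z‖ ≤ δ * ‖y - z‖ := by gcongr
  rw [← neg_sub y z, inner_neg_right] at e₁
  rw [inner_sub_left] at c₁ c₂
  rw [abs_le]
  constructor <;> linarith

theorem unitNormal_eq (h : IsUnitNormal B F x ν) (hu : ∀ ν', IsUnitNormal B F x ν' → ν' = ν) :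
    unitNormal B F x = ν := by
  have hex : ∃! ν, IsUnitNormal B F x ν := ⟨ν, h, hu⟩
  rw [unitNormal, dif_pos hex]
  exact hu _ hex.choose_spec.1

theorem unitNormal_eq_zero (h : ¬ ∃! ν, IsUnitNormal B F x ν) : unitNormal B F x = 0 :=
  dif_neg h

/-- The section contains a neighbourhood of 0 in its subspace, so its measure in the full dimension
is positive. -/
theorem euclideanHausdorffMeasure_centralSection_eq_top
    (h0 : (0 : EuclideanSpace ℝ (Fin n)) ∈ interior B) {d : ℕ}
    (hd : d < finrank ℝ (frameSpace F)) : μHE[d] (centralSection B F) = ∞ := by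
  refine (euclideanHausdorffMeasure_zero_or_top hd _).resolve_left ?_
  have : centralSection B F = (frameSpace F).subtypeₗᵢ ''
      (((↑) : frameSpace F → EuclideanSpace ℝ (Fin n)) ⁻¹' B) := by
    ext v; simp [centralSection]
  rw [this, (frameSpace F).subtypeₗᵢ.isometry.euclideanHausdorffMeasure_image]
  exact (measure_pos_of_mem_nhds _ (mem_interior_iff_mem_nhds.1
    (zero_mem_interior_preimage h0))).ne'

end Normals

/-! ### Sections and normals under a linear map -/

section LinearImage

variable (T : EuclideanSpace ℝ (Fin n) ≃L[ℝ] EuclideanSpace ℝ (Fin n))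

theorem centralSection_image (hF : T '' frameSpace F = frameSpace F') :
    centralSection (T '' B) F' = T '' centralSection B F := by
  rw [centralSection, centralSection, image_inter T.injective, hF]

theorem sectionBoundary_image (hF : T '' frameSpace F = frameSpace F') :
    sectionBoundary (T '' B) F' = T '' sectionBoundary B F := by
  have hmem : ∀ v, v ∈ frameSpace F ↔ T v ∈ frameSpace F' := fun v => by
    rw [← SetLike.mem_coe (p := frameSpace F'), ← hF, T.injective.mem_set_image, SetLike.mem_coe]
  let e : frameSpace F ≃ₜ frameSpace F' := T.toHomeomorph.subtype hmem
  have h : e '' (((↑) : frameSpace F → EuclideanSpace ℝ (Fin n)) ⁻¹' B) = (↑) ⁻¹' (T '' B) := by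
    ext ⟨w, hw⟩
    constructor
    · rintro ⟨v, hv, hvw⟩
      exact ⟨v, hv, congrArg Subtype.val hvw⟩
    · rintro ⟨v, hv, rfl⟩
      exact ⟨⟨v, (hmem v).2 hw⟩, hv, rfl⟩
  rw [sectionBoundary, ← h, ← e.image_frontier, sectionBoundary, image_image, image_image]
  rfl

theorem zero_mem_interior_image (h0 : (0 : EuclideanSpace ℝ (Fin n)) ∈ interior B) :
    (0 : EuclideanSpace ℝ (Fin n)) ∈ interior (T '' B) :=
  T.isOpenMap.image_interior_subset B ⟨0, h0, map_zero T⟩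

theorem finrank_frameSpace_eq_of_image (hF : T '' frameSpace F = frameSpace F') :
    finrank ℝ (frameSpace F') = finrank ℝ (frameSpace F) := by
  have h : (frameSpace F).map T.toLinearEquiv.toLinearMap = frameSpace F' :=
    SetLike.coe_injective hF
  rw [← h]
  exact LinearEquiv.finrank_map_eq T.toLinearEquiv _

/-- Normals pull back by the adjoint: ν₀ is the normalized projection of T*ν to the frame space. -/
theorem IsUnitNormal.exists_preimage (hx : x ∈ frameSpace F)
    (hF : T '' frameSpace F = frameSpace F') (h : IsUnitNormal (T '' B) F' (T x) ν) :
    ∃ ν₀, IsUnitNormal B F x ν₀ ∧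
      ∃ c : ℝ, 0 < c ∧ ∀ v ∈ frameSpace F, ⟪ν, T v⟫_ℝ = c * ⟪ν₀, v⟫_ℝ := by
  set w := (frameSpace F).starProjection ((T : _ →L[ℝ] _).adjoint ν) with hw
  have hwF : w ∈ frameSpace F := Submodule.starProjection_apply_mem _ _
  have hwv : ∀ v ∈ frameSpace F, ⟪w, v⟫_ℝ = ⟪ν, T v⟫_ℝ := fun v hv => by
    rw [hw, Submodule.inner_starProjection_left_eq_right,
      Submodule.starProjection_eq_self_iff.2 hv, ContinuousLinearMap.adjoint_inner_left]
    rfl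
  have hw0 : w ≠ 0 := by
    intro hw0
    obtain ⟨v, hv, hTv⟩ : ν ∈ T '' frameSpace F := by rw [hF]; exact h.1
    have := hwv v hv
    rw [hw0, hTv, inner_zero_left, real_inner_self_eq_norm_sq, h.2.1] at this
    norm_num at this
  refine ⟨_, isUnitNormal_inv_norm_smul hwF hw0 fun y hy => ?_, ‖w‖, norm_pos_iff.2 hw0,
    fun v hv => ?_⟩
  · rw [hwv _ (Submodule.sub_mem _ hy.2 hx), map_sub]
    refine h.2.2 _ ?_
    rw [centralSection_image T hF]
    exact mem_image_of_mem _ hy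
  · rw [real_inner_smul_left, hwv v hv, mul_inv_cancel_left₀ (norm_ne_zero_iff.2 hw0)]

theorem image_frameSpace_cons (hF : T '' frameSpace F = frameSpace F')
    {ν' : EuclideanSpace ℝ (Fin n)} {c : ℝ} (hc : c ≠ 0)
    (h : ∀ v ∈ frameSpace F, ⟪ν', T v⟫_ℝ = c * ⟪ν, v⟫_ℝ) :
    T '' frameSpace (ν :: F) = frameSpace (ν' :: F') := by
  ext w
  rw [SetLike.mem_coe, mem_frameSpace_cons, ← SetLike.mem_coe, ← hF]
  constructor
  · rintro ⟨v, hv, rfl⟩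
    obtain ⟨h1, h2⟩ := mem_frameSpace_cons.1 hv
    exact ⟨by rw [h v h2, h1, mul_zero], v, h2, rfl⟩
  · rintro ⟨h1, v, h2, rfl⟩
    refine ⟨v, mem_frameSpace_cons.2 ⟨?_, h2⟩, rfl⟩
    rw [h v h2] at h1
    exact (mul_eq_zero.1 h1).resolve_left hc

omit T in
theorem eq_of_inner_eq_mul {ν' : EuclideanSpace ℝ (Fin n)} (hν : ν ∈ frameSpace F)
    (hν' : ν' ∈ frameSpace F) (h1 : ‖ν‖ = 1) (h1' : ‖ν'‖ = 1) {c : ℝ} (hc : 0 < c)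
    (h : ∀ v ∈ frameSpace F, ⟪ν', v⟫_ℝ = c * ⟪ν, v⟫_ℝ) : ν' = ν := by
  have hsub : ν' - c • ν ∈ frameSpace F := Submodule.sub_mem _ hν' (Submodule.smul_mem _ _ hν)
  have h0 : ν' = c • ν := by
    rw [← sub_eq_zero, ← inner_self_eq_zero (𝕜 := ℝ), inner_sub_left, real_inner_smul_left,
      h _ hsub, sub_self]
  have hc1 : c = 1 := by
    have := congrArg norm h0
    rwa [h1', norm_smul, h1, mul_one, Real.norm_eq_abs, abs_of_pos hc, eq_comm] at this
  rw [h0, hc1, one_smul]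

theorem IsUnitNormal.unitNormal_preimage (hx : x ∈ frameSpace F)
    (hF : T '' frameSpace F = frameSpace F') (hex : ∃! ν, IsUnitNormal (T '' B) F' (T x) ν) :
    (∃! ν, IsUnitNormal B F x ν) ∧
      T '' frameSpace (unitNormal B F x :: F) =
        frameSpace (unitNormal (T '' B) F' (T x) :: F') := by
  obtain ⟨ν', hν', hu'⟩ := hex
  obtain ⟨ν₀, hν₀, c, hc, hcv⟩ := IsUnitNormal.exists_preimage T hx hF hν'
  have hF' : T.symm '' frameSpace F' = frameSpace F := by
    rw [← hF, ← image_comp]; simp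
  have hB' : T.symm '' (T '' B) = B := by
    rw [← image_comp]; simp
  have hTx : T x ∈ frameSpace F' := by
    rw [← SetLike.mem_coe, ← hF]; exact mem_image_of_mem _ hx
  -- Pulling a normal at x back along T⁻¹ gives the unique normal at T x, so the given normal is a
  -- positive multiple of ν₀.
  have hu : ∀ ν, IsUnitNormal B F x ν → ν = ν₀ := by
    intro ν hν
    have hν2 : IsUnitNormal (T.symm '' (T '' B)) F (T.symm (T x)) ν := by
      rwa [hB', T.symm_apply_apply]
    obtain ⟨ν₂, hν₂, c₂, hc₂, hcv₂⟩ := IsUnitNormal.exists_preimage T.symm hTx hF' hν2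
    obtain rfl := hu' _ hν₂
    refine eq_of_inner_eq_mul hν₀.1 hν.1 hν₀.2.1 hν.2.1 (mul_pos hc₂ hc) fun v hv => ?_
    have hTv : T v ∈ frameSpace F' := by
      rw [← SetLike.mem_coe, ← hF]; exact mem_image_of_mem _ hv
    have := hcv₂ _ hTv
    rw [T.symm_apply_apply, hcv v hv] at this
    rw [this, mul_assoc]
  refine ⟨⟨ν₀, hν₀, hu⟩, ?_⟩
  rw [unitNormal_eq hν₀ hu, unitNormal_eq hν' hu']
  exact image_frameSpace_cons T hF hc.ne' hcv

end LinearImage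

/-! ### Cancellation of Jacobians and induction on dimension -/

section Invariance

variable (B F) in
/-- The integrand in the definition of `frameSelfVolume`. -/
noncomputable def selfVolumeDensity (k : ℕ) (x : EuclideanSpace ℝ (Fin n)) : ℝ≥0∞ :=
  frameSelfVolume B k (unitNormal B F x :: F) / μHE[k] (centralSection B (unitNormal B F x :: F))

theorem existsUnique_of_selfVolumeDensity_ne_zero
    (h0 : (0 : EuclideanSpace ℝ (Fin n)) ∈ interior B) {k : ℕ}
    (hk : k < finrank ℝ (frameSpace F)) (hx : selfVolumeDensity B F k x ≠ 0) :
    ∃! ν, IsUnitNormal B F x ν := by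
  by_contra hcon
  refine hx ?_
  rw [selfVolumeDensity, unitNormal_eq_zero hcon,
    euclideanHausdorffMeasure_centralSection_eq_top h0 (by rwa [frameSpace_zero_cons]),
    ENNReal.div_top]

/-- The density of self-volume is inversely proportional to the distortion of surface area. -/
theorem subspaceJacobian_mul_selfVolumeDensity
    (T : EuclideanSpace ℝ (Fin n) ≃L[ℝ] EuclideanSpace ℝ (Fin n)) {k : ℕ}
    (hk : finrank ℝ (frameSpace (unitNormal B F x :: F)) = k)
    (hF : T '' frameSpace (unitNormal B F x :: F) =
      frameSpace (unitNormal (T '' B) F' (T x) :: F'))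
    (hT : frameSelfVolume (T '' B) k (unitNormal (T '' B) F' (T x) :: F') =
      frameSelfVolume B k (unitNormal B F x :: F)) :
    subspaceJacobian T (frameSpace (unitNormal B F x :: F)) *
      selfVolumeDensity (T '' B) F' k (T x) = selfVolumeDensity B F k x := by
  rw [selfVolumeDensity, selfVolumeDensity, hT, centralSection_image T hF]
  subst hk
  have hsub : centralSection B (unitNormal B F x :: F) ⊆ frameSpace (unitNormal B F x :: F) :=
    inter_subset_right
  rw [euclideanHausdorffMeasure_image_of_subset T _ hsub, div_eq_mul_inv,
    div_eq_mul_inv, ENNReal.mul_inv (.inl (subspaceJacobian_ne_zero _ _))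
      (.inl (subspaceJacobian_ne_top _ _)), mul_left_comm, ← mul_assoc (subspaceJacobian _ _),
    ENNReal.mul_inv_cancel (subspaceJacobian_ne_zero _ _) (subspaceJacobian_ne_top _ _), one_mul]

theorem le_of_forall_one_lt_pow_mul {a b : ℝ≥0∞} (m : ℕ)
    (h : ∀ ρ : ℝ≥0, 1 < ρ → a ≤ (ρ : ℝ≥0∞) ^ m * b) : a ≤ b := by
  have hc : Filter.Tendsto (fun ρ : ℝ≥0 => (ρ : ℝ≥0∞) ^ m * b) (𝓝[>] 1)
      (𝓝 (((1 : ℝ≥0) : ℝ≥0∞) ^ m * b)) := by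
    refine ENNReal.Tendsto.mul_const ?_ (.inl (by simp))
    exact ((ENNReal.continuous_pow m).comp ENNReal.continuous_coe).continuousAt.tendsto.mono_left
      nhdsWithin_le_nhds
  rw [ENNReal.coe_one, one_pow, one_mul] at hc
  exact ge_of_tendsto hc (eventually_mem_nhdsWithin.mono h)

theorem setLIntegral_selfVolumeDensity_image_le (hB : Convex ℝ B)
    (h0 : (0 : EuclideanSpace ℝ (Fin n)) ∈ interior B)
    (T : EuclideanSpace ℝ (Fin n) ≃L[ℝ] EuclideanSpace ℝ (Fin n)) {k : ℕ}
    (hk : finrank ℝ (frameSpace F) = k + 1) (hF : T '' frameSpace F = frameSpace F')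
    (IH : ∀ G G' : List (EuclideanSpace ℝ (Fin n)), finrank ℝ (frameSpace G) = k →
      T '' frameSpace G = frameSpace G' → frameSelfVolume (T '' B) k G' = frameSelfVolume B k G) :
    ∫⁻ x in sectionBoundary (T '' B) F', selfVolumeDensity (T '' B) F' k x ∂μHE[k] ≤
      ∫⁻ x in sectionBoundary B F, selfVolumeDensity B F k x ∂μHE[k] := by
  -- One factor ρ^(2k) pays for the distortion of measure, the other for the variation of the
  -- tangent Jacobian.
  refine le_of_forall_one_lt_pow_mul (2 * k + 2 * k) fun ρ hρ => ?_
  have hρ1 : (1 : ℝ≥0∞) ≤ ρ := by exact_mod_cast hρ.le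
  obtain ⟨δ₁, hδ₁, H₁⟩ := exists_subspaceJacobian_bounds T hρ
  obtain ⟨δ₂, hδ₂, H₂⟩ := exists_subspaceJacobian_le T hρ
  rw [sectionBoundary_image T hF, pow_add]
  refine setLIntegral_image_le_of_locally T.toHomeomorph _ _ isClosed_sectionBoundary.measurableSet
    _ _ (ENNReal.pow_ne_top ENNReal.coe_ne_top) fun x hx hne => ?_
  have h0' := zero_mem_interior_image T h0
  have hk' := (finrank_frameSpace_eq_of_image T hF).trans hk
  have hreg : ∀ y ∈ sectionBoundary B F, selfVolumeDensity (T '' B) F' k (T y) ≠ 0 →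
      (∃! ν, IsUnitNormal B F y ν) ∧ T '' frameSpace (unitNormal B F y :: F) =
        frameSpace (unitNormal (T '' B) F' (T y) :: F') := fun y hy hne =>
    IsUnitNormal.unitNormal_preimage T (sectionBoundary_subset_frameSpace hy) hF
      (existsUnique_of_selfVolumeDensity_ne_zero h0' (by omega) hne)
  have hfr : ∀ {ν}, ν ∈ frameSpace F → ‖ν‖ = 1 → finrank ℝ (frameSpace (ν :: F)) = k := by
    intro ν hν h1
    have := finrank_frameSpace_cons hν h1
    omega
  obtain ⟨⟨ν, hν, hu⟩, -⟩ := hreg x hx hne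
  obtain ⟨U, hU, hUo, hxU⟩ := mem_nhds_iff.1
    (eventually_isUnitNormal_dist_lt hu (lt_min hδ₁ hδ₂))
  have hd := hfr hν.1 hν.2.1
  -- The local scaling factor is the Jacobian on the tangent hyperplane at the centre x.
  refine ⟨subspaceJacobian T (frameSpace (ν :: F)), U, hUo, hxU, fun A hA => ?_, fun y hy => ?_⟩
  · have h := (H₁ (frameSpace (ν :: F)) A fun y hy z hz => ?_).1
    · rw [hd] at h
      refine h.trans ?_
      gcongr
      omega
    · have hyF := (hA hy).2
      have hzF := (hA hz).2
      obtain ⟨ν₁, hν₁⟩ := exists_isUnitNormal hB h0 hyF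
      obtain ⟨ν₂, hν₂⟩ := exists_isUnitNormal hB h0 hzF
      rw [norm_sub_starProjection_frameSpace_cons hν.1 hν.2.1 (Submodule.sub_mem _
        (sectionBoundary_subset_frameSpace hyF) (sectionBoundary_subset_frameSpace hzF))]
      exact abs_inner_sub_le_of_isUnitNormal hyF hzF hν₁ hν₂
        ((hU (hA hy).1 _ hν₁).trans_le (min_le_left _ _))
        ((hU (hA hz).1 _ hν₂).trans_le (min_le_left _ _))
  · by_cases hne : selfVolumeDensity (T '' B) F' k (T y) = 0
    · rw [show T.toHomeomorph y = T y from rfl, hne, mul_zero]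
      exact zero_le
    obtain ⟨⟨ν₁, hν₁, hu₁⟩, hF₁⟩ := hreg y hy.2 hne
    have hy₁ := unitNormal_eq hν₁ hu₁
    have hd₁ := hfr hν₁.1 hν₁.2.1
    have hJ := H₂ (frameSpace (ν :: F)) (frameSpace (ν₁ :: F)) (hd.trans hd₁.symm) fun v hv => by
      obtain ⟨hv0, hvF⟩ := mem_frameSpace_cons.1 hv
      rw [norm_sub_starProjection_frameSpace_cons hν.1 hν.2.1 hvF]
      have h1 : ⟪ν, v⟫_ℝ = -⟪ν₁ - ν, v⟫_ℝ := by rw [inner_sub_left, hv0]; ring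
      rw [h1, abs_neg]
      refine (abs_real_inner_le_norm _ _).trans ?_
      gcongr
      exact ((hU hy.1 _ hν₁).trans_le (min_le_right _ _)).le
    rw [hd] at hJ
    have hdens := subspaceJacobian_mul_selfVolumeDensity (x := y) T (by rwa [hy₁]) hF₁
      (IH _ _ (by rwa [hy₁]) hF₁)
    rw [← hdens, hy₁, ← mul_assoc]
    gcongr
    rfl

/-- T need not carry one frame to the other or preserve orthogonality; matching the orthogonal
spaces is what survives the induction. -/
theorem frameSelfVolume_image (T : EuclideanSpace ℝ (Fin n) ≃L[ℝ] EuclideanSpace ℝ (Fin n))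
    (hB : Convex ℝ B) (h0 : (0 : EuclideanSpace ℝ (Fin n)) ∈ interior B) {k : ℕ}
    (hk : finrank ℝ (frameSpace F) = k) (hF : T '' frameSpace F = frameSpace F') :
    frameSelfVolume (T '' B) k F' = frameSelfVolume B k F := by
  induction k using Nat.twoStepInduction generalizing T B F F' with
  | zero => simp only [frameSelfVolume]
  | one => simp only [frameSelfVolume]
  | more k _ IH =>
    simp only [frameSelfVolume]
    congr 1
    refine le_antisymm ?_ ?_
    · exact setLIntegral_selfVolumeDensity_image_le hB h0 T hk hF
        fun G G' hG hGG' => IH T hB h0 hG hGG'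
    · have h0' := zero_mem_interior_image T h0
      have hk' := (finrank_frameSpace_eq_of_image T hF).trans hk
      have hF' : T.symm '' frameSpace F' = frameSpace F := by
        rw [← hF, ← image_comp]; simp
      have hB' : T.symm '' (T '' B) = B := by
        rw [← image_comp]; simp
      have hTB : Convex ℝ (T '' B) := hB.linear_image T.toLinearEquiv.toLinearMap
      -- The reverse inequality is the same one for T⁻¹ and T(B), which is why the induction
      -- generalizes over the map and the body.
      have := setLIntegral_selfVolumeDensity_image_le hTB h0' T.symm hk' hF'
        fun G G' hG hGG' => IH T.symm hTB h0' hG hGG'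
      rwa [hB'] at this

end Invariance

end SelfPerimeter

theorem theorem4p5 (n : ℕ) (hn : 1 ≤ n) (B : Set (EuclideanSpace ℝ (Fin n)))
    (hB : Convex ℝ B) (h0 : (0 : EuclideanSpace ℝ (Fin n)) ∈ interior B)
    (T : EuclideanSpace ℝ (Fin n) ≃ᵃ[ℝ] EuclideanSpace ℝ (Fin n)) (hT : T 0 = 0) :
    SelfPerimeter.selfVolume (T '' B) = SelfPerimeter.selfVolume B := by 
  have hT' : ∀ x, T x = T.linear x := fun x => by
    have := T.map_vadd 0 x
    simpa [hT] using this
  have himg : T '' B = T.linear.toContinuousLinearEquiv '' B := image_congr fun x _ => hT' x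
  rw [himg]
  refine SelfPerimeter.frameSelfVolume_image _ hB h0 ?_ ?_
  · rw [SelfPerimeter.frameSpace_nil]; simp
  · simp [SelfPerimeter.frameSpace_nil]
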